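/- Let $S,K\subset\mathbb{R}$ be nonempty bounded open intervals and let $h>0$. For $y>0$ put $P_y(x)=\frac1\pi\frac{y}{x^2+y^2}$ and $Q_y(x)=\frac1\pi\frac{x}{x^2+y^2}$, and let $\widetilde u$ denote the extension by zero to $\mathbb{R}$ of a function $u$ on an interval. Write $L^2(K)=L^2(K,\mathbb{R})$, and equip $L^2(S,\mathbb{R}^2)$ with the inner product $\langle f,g\rangle=\langle f_1,g_1\rangle_{L^2(S)}+\langle f_2,g_2\rangle_{L^2(S)}$. Let $b_2:L^2(S,\mathbb{R}^2)\to L^2(K)$ be the bounded operator $$b_2[\boldsymbol m](x)=-\,\partial_y\left(Q_y\star\widetilde{m_1}+P_y\star\widetilde{m_2}\right)(x)\Big|_{y=h},\qquad x\in K,\quad \boldsymbol m=(m_1,m_2),$$ and let $b_2^*:L^2(K)\to L^2(S,\mathbb{R}^2)$ be its adjoint. Let $\boldsymbol e\in L^2(S,\mathbb{R}^2)$ and $M\ge 0$. Then there is a unique $\phi_o\in L^2(K)$ with $\|\phi_o\|_{L^2(K)}\le M$ such that $$\|b_2^*[\phi_o]-\boldsymbol e\|_{L^2(S,\mathbb{R}^2)}=\min_{\phi\in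 L^2(K),\ \|\phi\|_{L^2(K)}\le M}\|b_2^*[\phi]-\boldsymbol e\|_{L^2(S,\mathbb{R}^2)}.$$ Moreover, if $\boldsymbol e\notin\mathrm{Ran}\,b_2^*$, then $\|\phi_o\|_{L^2(K)}=M$. -/

import Mathlib

open MeasureTheory Set

namespace PlanarMagnetization

open scoped Convolution

noncomputable section

/-- `L²(I)` for the open interval `I = (a, b)`: real-valued square-integrable functions. -/
abbrev L2 (a b : ℝ) : Type := Lp ℝ 2 (volume.restrict (Ioo a b))

/-- `L²(I, ℝ²)` for the open interval `I = (a, b)`, with `ℝ²` Euclidean, so that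
`⟪f, g⟫ = ⟪f₁, g₁⟫ + ⟪f₂, g₂⟫`. -/
abbrev L2Vec (a b : ℝ) : Type := Lp (EuclideanSpace ℝ (Fin 2)) 2 (volume.restrict (Ioo a b))

/-- The Poisson kernel `P_y` of the upper half-plane. -/
def P (y x : ℝ) : ℝ := 1 / Real.pi * (y / (x ^ 2 + y ^ 2))

/-- The conjugate Poisson kernel `Q_y` of the upper half-plane. -/
def Q (y x : ℝ) : ℝ := 1 / Real.pi * (x / (x ^ 2 + y ^ 2))

/-- The extension by zero to `ℝ` of the `i`-th component of `m ∈ L²((a, b), ℝ²)`. -/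
def zeroExt {a b : ℝ} (m : L2Vec a b) (i : Fin 2) : ℝ → ℝ := (Ioo a b).indicator fun t => m t i

/-- The potential `(Q_y ⋆ m̃₁ + P_y ⋆ m̃₂)(x)` at the point `(x, y)` of the upper half-plane of the
magnetization `m` (up to a multiplicative constant). -/
def potential {a b : ℝ} (m : L2Vec a b) (x y : ℝ) : ℝ :=
  (Q y ⋆ zeroExt m 0) x + (P y ⋆ zeroExt m 1) x

/-- The vertical component `-∂_y (Q_y ⋆ m̃₁ + P_y ⋆ m̃₂)(x)` at `y = h` of the magnetic field. -/
def field {a b : ℝ} (h : ℝ) (m : L2Vec a b) (x : ℝ) : ℝ :=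
  -deriv (fun y => potential m x y) h

/-! The vertical field is a bounded operator `L²(S, ℝ²) → L²(K)`. -/

/-- `∂_y Q_y`. -/
def dQ (y x : ℝ) : ℝ := 1 / Real.pi * (-(2 * x * y) / (x ^ 2 + y ^ 2) ^ 2)

/-- `∂_y P_y`. -/
def dP (y x : ℝ) : ℝ := 1 / Real.pi * ((x ^ 2 - y ^ 2) / (x ^ 2 + y ^ 2) ^ 2)

lemma hasDerivAt_Q {y : ℝ} (hy : 0 < y) (x : ℝ) : HasDerivAt (fun y => Q y x) (dQ y x) y := by
  have h0 : x ^ 2 + y ^ 2 ≠ 0 := by positivity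
  have h1 : HasDerivAt (fun y : ℝ => x ^ 2 + y ^ 2) (2 * y) y := by
    simpa using (hasDerivAt_pow 2 y).const_add (x ^ 2)
  have h2 := ((hasDerivAt_const y x).div h1 h0).const_mul (1 / Real.pi)
  refine h2.congr_deriv ?_
  simp only [dQ]
  ring

lemma hasDerivAt_P {y : ℝ} (hy : 0 < y) (x : ℝ) : HasDerivAt (fun y => P y x) (dP y x) y := by
  have h0 : x ^ 2 + y ^ 2 ≠ 0 := by positivity
  have h1 : HasDerivAt (fun y : ℝ => x ^ 2 + y ^ 2) (2 * y) y := by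
    simpa using (hasDerivAt_pow 2 y).const_add (x ^ 2)
  have h2 := ((hasDerivAt_id y).div h1 h0).const_mul (1 / Real.pi)
  refine h2.congr_deriv ?_
  simp only [dP, id]
  ring

lemma abs_kernel_le {δ y : ℝ} (hδ : 0 < δ) (hy : δ ≤ y) (x : ℝ) :
    |dQ y x| ≤ 1 / δ ^ 2 ∧ |dP y x| ≤ 1 / δ ^ 2 := by
  have hy0 : 0 < y := hδ.trans_le hy
  have hs : 0 < x ^ 2 + y ^ 2 := by positivity
  have hpi : |1 / Real.pi| ≤ 1 := by
    rw [abs_of_pos (by positivity), div_le_one Real.pi_pos]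
    linarith [Real.pi_gt_three]
  have hδ2 : δ ^ 2 ≤ x ^ 2 + y ^ 2 := by nlinarith [sq_nonneg x]
  have key : ∀ c : ℝ, |c| ≤ x ^ 2 + y ^ 2 →
      |1 / Real.pi * (c / (x ^ 2 + y ^ 2) ^ 2)| ≤ 1 / δ ^ 2 := by
    intro c hc
    rw [abs_mul, abs_div c, abs_of_pos (by positivity : 0 < (x ^ 2 + y ^ 2) ^ 2)]
    calc |1 / Real.pi| * (|c| / (x ^ 2 + y ^ 2) ^ 2)
        ≤ 1 * ((x ^ 2 + y ^ 2) / (x ^ 2 + y ^ 2) ^ 2) := by gcongr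
      _ = 1 / (x ^ 2 + y ^ 2) := by field_simp
      _ ≤ 1 / δ ^ 2 := by gcongr
  constructor
  · refine key _ (abs_le.2 ⟨?_, ?_⟩) <;> nlinarith [sq_nonneg (x - y), sq_nonneg (x + y)]
  · refine key _ (abs_le.2 ⟨?_, ?_⟩) <;> nlinarith [sq_nonneg x, sq_nonneg y]

lemma measurable_P : Measurable (Function.uncurry P) := by
  unfold P Function.uncurry; fun_prop

lemma measurable_Q : Measurable (Function.uncurry Q) := by
  unfold Q Function.uncurry; fun_prop

lemma measurable_dP : Measurable (Function.uncurry dP) := by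
  unfold dP Function.uncurry; fun_prop

lemma measurable_dQ : Measurable (Function.uncurry dQ) := by
  unfold dQ Function.uncurry; fun_prop

/-- A convolution with a zero extension, as an integral over the interval. -/
lemma conv_ext {a b : ℝ} (m : L2Vec a b) (i : Fin 2) (k : ℝ → ℝ) (x : ℝ) :
    (k ⋆ zeroExt m i) x = ∫ t in Ioo a b, k (x - t) * m t i := by
  rw [convolution_lsmul_swap, ← integral_indicator measurableSet_Ioo]
  congr 1
  funext t
  by_cases ht : t ∈ Ioo a b <;> simp [zeroExt, ht]

lemma integrable_comp {a b : ℝ} (m : L2Vec a b) (i : Fin 2) :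
    Integrable (fun t => m t i) (volume.restrict (Ioo a b)) := by
  have h : Integrable m (volume.restrict (Ioo a b)) := (Lp.memLp m).integrable (by norm_num)
  refine h.mono (by
    exact (EuclideanSpace.proj (𝕜 := ℝ) i).continuous.comp_aestronglyMeasurable
      h.aestronglyMeasurable) (ae_of_all _ fun t => ?_)
  exact PiLp.norm_apply_le (m t) i

lemma integrable_kernel {a b : ℝ} (m : L2Vec a b) (i : Fin 2) {k : ℝ → ℝ} (hk : Measurable k)
    {C : ℝ} (hC : ∀ x, |k x| ≤ C) (x : ℝ) :
    Integrable (fun t => k (x - t) * m t i) (volume.restrict (Ioo a b)) :=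
  (integrable_comp m i).bdd_mul (c := C)
    (hk.comp (measurable_const.sub measurable_id)).aestronglyMeasurable
    (ae_of_all _ fun _ => hC _)

lemma abs_P_Q_le {y : ℝ} (hy : 0 < y) (x : ℝ) : |Q y x| ≤ 1 / y ∧ |P y x| ≤ 1 / y := by
  have hs : 0 < x ^ 2 + y ^ 2 := by positivity
  have hpi : |1 / Real.pi| ≤ 1 := by
    rw [abs_of_pos (by positivity), div_le_one Real.pi_pos]
    linarith [Real.pi_gt_three]
  have key : ∀ c : ℝ, |c| * y ≤ x ^ 2 + y ^ 2 →
      |1 / Real.pi * (c / (x ^ 2 + y ^ 2))| ≤ 1 / y := by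
    intro c hc
    rw [abs_mul, abs_div c, abs_of_pos hs]
    calc |1 / Real.pi| * (|c| / (x ^ 2 + y ^ 2)) ≤ 1 * (|c| / (x ^ 2 + y ^ 2)) := by gcongr
      _ ≤ 1 / y := by rw [one_mul, div_le_div_iff₀ hs hy]; linarith
  constructor
  · refine key _ ?_
    nlinarith [sq_nonneg (|x| - y), sq_abs x, sq_nonneg (|x| + y)]
  · refine key _ ?_
    rw [abs_of_pos hy]
    nlinarith [sq_nonneg x]

/-- Differentiation under the integral sign. -/
lemma hasDerivAt_integral_kernel {a b h : ℝ} (hh : 0 < h) (m : L2Vec a b) (i : Fin 2)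
    {k dk : ℝ → ℝ → ℝ} (hk : Measurable (Function.uncurry k))
    (hdk : Measurable (Function.uncurry dk))
    (hd : ∀ y, 0 < y → ∀ x, HasDerivAt (fun y => k y x) (dk y x) y)
    (hkb : ∀ y, 0 < y → ∀ x, |k y x| ≤ 1 / y)
    (hdkb : ∀ δ y, 0 < δ → δ ≤ y → ∀ x, |dk y x| ≤ 1 / δ ^ 2) (x : ℝ) :
    HasDerivAt (fun y => ∫ t in Ioo a b, k y (x - t) * m t i)
      (∫ t in Ioo a b, dk h (x - t) * m t i) h := by
  have hk' : ∀ y, Measurable (k y) := fun y => hk.comp measurable_prodMk_left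
  have hdk' : ∀ y, Measurable (dk y) := fun y => hdk.comp measurable_prodMk_left
  have hc := integrable_comp m i
  have hsub : ∀ x : ℝ, Measurable fun t : ℝ => x - t :=
    fun x => measurable_const.sub measurable_id
  refine (hasDerivAt_integral_of_dominated_loc_of_deriv_le
    (F := fun y t => k y (x - t) * m t i) (F' := fun y t => dk y (x - t) * m t i)
    (bound := fun t => 1 / (h / 2) ^ 2 * ‖m t i‖) (s := Ioi (h / 2))
    (Ioi_mem_nhds (by linarith)) (Filter.Eventually.of_forall fun y => ?_) ?_ ?_ ?_ ?_ ?_).2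
  · exact ((hk' y).comp (hsub x)).aestronglyMeasurable.mul hc.aestronglyMeasurable
  · exact integrable_kernel m i (hk' h) (hkb h hh) x
  · exact ((hdk' h).comp (hsub x)).aestronglyMeasurable.mul hc.aestronglyMeasurable
  · refine ae_of_all _ fun t y hy => ?_
    rw [norm_mul]
    exact mul_le_mul_of_nonneg_right (hdkb (h / 2) y (by linarith) (le_of_lt hy) _) (norm_nonneg _)
  · exact hc.norm.const_mul _
  · refine ae_of_all _ fun t y hy => ?_
    have hy' : h / 2 < y := hy
    exact (hd y (by linarith) (x - t)).mul_const _

/-- The vertical field as an integral operator on `(a, b)`. -/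
lemma hasDerivAt_potential {a b h : ℝ} (hh : 0 < h) (m : L2Vec a b) (x : ℝ) :
    HasDerivAt (fun y => potential m x y)
      ((∫ t in Ioo a b, dQ h (x - t) * m t 0) + ∫ t in Ioo a b, dP h (x - t) * m t 1) h := by
  simp only [potential, conv_ext]
  exact (hasDerivAt_integral_kernel hh m 0 measurable_Q measurable_dQ (fun y hy => hasDerivAt_Q hy)
      (fun y hy x => (abs_P_Q_le hy x).1) (fun δ y hδ hy x => (abs_kernel_le hδ hy x).1) x).add
    (hasDerivAt_integral_kernel hh m 1 measurable_P measurable_dP (fun y hy => hasDerivAt_P hy)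
      (fun y hy x => (abs_P_Q_le hy x).2) (fun δ y hδ hy x => (abs_kernel_le hδ hy x).2) x)

lemma field_eq {a b h : ℝ} (hh : 0 < h) (m : L2Vec a b) (x : ℝ) :
    field h m x =
      -((∫ t in Ioo a b, dQ h (x - t) * m t 0) + ∫ t in Ioo a b, dP h (x - t) * m t 1) := by
  rw [field, (hasDerivAt_potential hh m x).deriv]

lemma integrable_dQ {a b h : ℝ} (hh : 0 < h) (m : L2Vec a b) (x : ℝ) :
    Integrable (fun t => dQ h (x - t) * m t 0) (volume.restrict (Ioo a b)) :=
  integrable_kernel m 0 (measurable_dQ.comp measurable_prodMk_left)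
    (fun x => (abs_kernel_le hh le_rfl x).1) x

lemma integrable_dP {a b h : ℝ} (hh : 0 < h) (m : L2Vec a b) (x : ℝ) :
    Integrable (fun t => dP h (x - t) * m t 1) (volume.restrict (Ioo a b)) :=
  integrable_kernel m 1 (measurable_dP.comp measurable_prodMk_left)
    (fun x => (abs_kernel_le hh le_rfl x).2) x

lemma field_add {a b h : ℝ} (hh : 0 < h) (m m' : L2Vec a b) (x : ℝ) :
    field h (m + m') x = field h m x + field h m' x := by
  have hadd : ∀ i : Fin 2, ∀ k : ℝ → ℝ,
      (∫ t in Ioo a b, k t * (m + m') t i) = ∫ t in Ioo a b, (k t * m t i + k t * m' t i) := by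
    intro i k
    refine integral_congr_ae ?_
    filter_upwards [Lp.coeFn_add m m'] with t ht
    rw [ht]
    simp [mul_add]
  rw [field_eq hh, field_eq hh, field_eq hh, hadd 0, hadd 1,
    integral_add (integrable_dQ hh m x) (integrable_dQ hh m' x),
    integral_add (integrable_dP hh m x) (integrable_dP hh m' x)]
  ring

lemma field_smul {a b h : ℝ} (hh : 0 < h) (c : ℝ) (m : L2Vec a b) (x : ℝ) :
    field h (c • m) x = c * field h m x := by
  have hsmul : ∀ i : Fin 2, ∀ k : ℝ → ℝ,
      (∫ t in Ioo a b, k t * (c • m) t i) = c * ∫ t in Ioo a b, k t * m t i := by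
    intro i k
    rw [← integral_const_mul]
    refine integral_congr_ae ?_
    filter_upwards [Lp.coeFn_smul c m] with t ht
    rw [ht]
    simp only [Pi.smul_apply, PiLp.smul_apply, smul_eq_mul]
    ring
  rw [field_eq hh, field_eq hh, hsmul 0, hsmul 1]
  ring

lemma measurable_field {a b h : ℝ} (hh : 0 < h) (m : L2Vec a b) :
    StronglyMeasurable (field h m) := by
  have hm : StronglyMeasurable (m : ℝ → EuclideanSpace ℝ (Fin 2)) := Lp.stronglyMeasurable m
  have hi : ∀ i : Fin 2, StronglyMeasurable fun p : ℝ × ℝ => m p.2 i := fun i =>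
    ((EuclideanSpace.proj (𝕜 := ℝ) i).continuous.comp_stronglyMeasurable hm).comp_measurable
      measurable_snd
  have hk : ∀ k : ℝ → ℝ → ℝ, Measurable (Function.uncurry k) →
      StronglyMeasurable fun p : ℝ × ℝ => k h (p.1 - p.2) := fun k hk =>
    (hk.comp (measurable_const.prodMk (measurable_fst.sub measurable_snd))).stronglyMeasurable
  rw [show field h m = _ from funext (field_eq hh m)]
  exact (((hk dQ measurable_dQ).mul (hi 0)).integral_prod_right.add
    ((hk dP measurable_dP).mul (hi 1)).integral_prod_right).neg

lemma integral_norm_le {a b : ℝ} (m : L2Vec a b) :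
    ∫ t in Ioo a b, ‖m t‖ ≤
      ((volume.restrict (Ioo a b)) univ ^ (1 / 2 : ℝ)).toReal * ‖m‖ := by
  have h := eLpNorm_le_eLpNorm_mul_rpow_measure_univ (p := 1) (q := 2) (by norm_num)
    (Lp.aestronglyMeasurable m)
  have e : (1 / (1 : ENNReal).toReal - 1 / (2 : ENNReal).toReal) = (1 / 2 : ℝ) := by norm_num
  rw [e] at h
  rw [integral_norm_eq_lintegral_enorm (Lp.aestronglyMeasurable m), ← eLpNorm_one_eq_lintegral_enorm,
    Lp.norm_def, mul_comm, ← ENNReal.toReal_mul]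
  refine ENNReal.toReal_mono (ENNReal.mul_ne_top (Lp.eLpNorm_ne_top m) ?_) h
  exact ENNReal.rpow_ne_top_of_nonneg (by norm_num) (measure_ne_top _ _)

lemma abs_field_le {a b h : ℝ} (hh : 0 < h) (m : L2Vec a b) (x : ℝ) :
    |field h m x| ≤
      2 / h ^ 2 * ((volume.restrict (Ioo a b)) univ ^ (1 / 2 : ℝ)).toReal * ‖m‖ := by
  have hn : Integrable (fun t => ‖m t‖) (volume.restrict (Ioo a b)) :=
    ((Lp.memLp m).integrable (by norm_num)).norm
  have key : ∀ i : Fin 2, ∀ k : ℝ → ℝ, (∀ x, |k x| ≤ 1 / h ^ 2) →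
      |∫ t in Ioo a b, k (x - t) * m t i| ≤ 1 / h ^ 2 * ∫ t in Ioo a b, ‖m t‖ := by
    intro i k hk
    rw [← integral_const_mul, ← Real.norm_eq_abs]
    refine norm_integral_le_of_norm_le (hn.const_mul _) (ae_of_all _ fun t => ?_)
    rw [norm_mul]
    exact mul_le_mul (hk _) (PiLp.norm_apply_le (m t) i) (norm_nonneg _) (by positivity)
  have h1 := key 0 (dQ h) fun x => (abs_kernel_le hh le_rfl x).1
  have h2 := key 1 (dP h) fun x => (abs_kernel_le hh le_rfl x).2
  rw [field_eq hh, abs_neg]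
  calc _ ≤ _ := abs_add_le _ _
    _ ≤ 2 / h ^ 2 * ∫ t in Ioo a b, ‖m t‖ := by
      refine (add_le_add h1 h2).trans_eq ?_
      ring
    _ ≤ _ := by
      rw [mul_assoc]
      exact mul_le_mul_of_nonneg_left (integral_norm_le m) (by positivity)

lemma memLp_field {a b h : ℝ} (hh : 0 < h) (c d : ℝ) (m : L2Vec a b) :
    MemLp (field h m) 2 (volume.restrict (Ioo c d)) :=
  MemLp.of_bound (measurable_field hh m).aestronglyMeasurable _
    (ae_of_all _ fun x => abs_field_le hh m x)

/-- The bounded operator `b₂ : L²(S, ℝ²) → L²(K)`, `S = (s₁, s₂)`, `K = (k₁, k₂)`, which maps a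
magnetization `m` to the restriction to `K × {h}` of `-∂_y (Q_y ⋆ m̃₁ + P_y ⋆ m̃₂)`. -/
def b2 (s₁ s₂ k₁ k₂ : ℝ) {h : ℝ} (hh : 0 < h) : L2Vec s₁ s₂ →L[ℝ] L2 k₁ k₂ :=
  LinearMap.mkContinuousOfExistsBound
    { toFun := fun m => (memLp_field hh k₁ k₂ m).toLp (field h m)
      map_add' := fun m m' => by
        rw [← MemLp.toLp_add (memLp_field hh k₁ k₂ m) (memLp_field hh k₁ k₂ m')]
        exact MemLp.toLp_congr _ _ (ae_of_all _ fun x => field_add hh m m' x)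
      map_smul' := fun c m => by
        rw [RingHom.id_apply, ← MemLp.toLp_const_smul c (memLp_field hh k₁ k₂ m)]
        exact MemLp.toLp_congr _ _ (ae_of_all _ fun x => field_smul hh c m x) } (by
    refine ⟨(measureUnivNNReal (volume.restrict (Ioo k₁ k₂)) : ℝ) ^ (2 : ENNReal).toReal⁻¹ *
      (2 / h ^ 2 * ((volume.restrict (Ioo s₁ s₂)) univ ^ (1 / 2 : ℝ)).toReal), fun m => ?_⟩
    rw [mul_assoc]
    refine Lp.norm_le_of_ae_bound (by positivity) ?_
    filter_upwards [(memLp_field hh k₁ k₂ m).coeFn_toLp] with x hx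
    exact (congrArg norm hx).trans_le (abs_field_le hh m x))

/-- The adjoint operator `b₂* : L²(K) → L²(S, ℝ²)` of `b₂`. -/
def b2Adjoint (s₁ s₂ k₁ k₂ : ℝ) {h : ℝ} (hh : 0 < h) : L2 k₁ k₂ →L[ℝ] L2Vec s₁ s₂ :=
  ContinuousLinearMap.adjoint (b2 s₁ s₂ k₁ k₂ hh)

/-- `φ₀` solves the bounded extremal problem of minimizing `‖b₂* φ - e‖` over all `φ ∈ L²(K)` with
`‖φ‖ ≤ M`. -/
def IsBEPSolution (s₁ s₂ k₁ k₂ : ℝ) {h : ℝ} (hh : 0 < h) (e : L2Vec s₁ s₂) (M : ℝ)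
    (φ₀ : L2 k₁ k₂) : Prop :=
  ‖φ₀‖ ≤ M ∧ ∀ φ : L2 k₁ k₂, ‖φ‖ ≤ M →
    ‖b2Adjoint s₁ s₂ k₁ k₂ hh φ₀ - e‖ ≤ ‖b2Adjoint s₁ s₂ k₁ k₂ hh φ - e‖

end

end PlanarMagnetization

/-! Existence is weak-* compactness of the ball together with lower semicontinuity of the norm
(`exists_min_norm_sub_closedBall`). The other claims rest on two injectivity statements. If
`b2Adjoint` is injective, strict convexity of the norm gives uniqueness. If `b2` is injective, its
adjoint has dense range; a minimizer inside the open ball would then be a global minimizer of a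
convex function with infimum zero, which puts `e` in the range.

Both injectivities come from the identity `1/(x+ih)² = π(∂_yP_h(x) + i ∂_yQ_h(x))`, which turns the
real kernels into the transform `cauchySq`. For `b2`, put `g = m₂ - i m₁`: a zero field says that
the transform of `g` shifted by `ih` and minus that of `conj g` shifted by `-ih` agree on `K`. They
are holomorphic on overlapping half-planes and glue to a bounded entire function that decays along
the imaginary axis, so it is zero by Liouville. For `b2Adjoint`, both kernel components vanish,
hence the whole complex transform of `φ` vanishes on a segment, and the identity theorem alone
suffices. In both cases `ae_eq_zero_of_cauchySq_eq_zero` concludes: expansion at infinity yields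
zero moments, and Weierstrass approximation yields the zero function. -/

namespace PlanarMagnetization

/-! ### Best approximation on balls of a Hilbert space -/

section BestApproximation

open Filter Topology InnerProductSpace

variable {H E : Type*} [NormedAddCommGroup H] [InnerProductSpace ℝ H] [CompleteSpace H]
  [NormedAddCommGroup E] [InnerProductSpace ℝ E] [CompleteSpace E]

/-- A bounded operator between Hilbert spaces attains its minimal distance to a given vector on
every closed ball. -/
lemma exists_min_norm_sub_closedBall (A : H →L[ℝ] E) (e : E) {M : ℝ} (hM : 0 ≤ M) :
    ∃ φ₀ : H, ‖φ₀‖ ≤ M ∧ ∀ φ : H, ‖φ‖ ≤ M → ‖A φ₀ - e‖ ≤ ‖A φ - e‖ := by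
  -- The Riesz isomorphism moves the problem to the weak dual, where Banach–Alaoglu applies.
  let R : WeakDual ℝ H → H := fun l => (toDual ℝ H).symm (WeakDual.toStrongDual l)
  have hR : ∀ (l : WeakDual ℝ H) (x : H), ⟪R l, x⟫_ℝ = l x := fun l x =>
    toDual_symm_apply
  have hcpt : IsCompact (WeakDual.toStrongDual ⁻¹' Metric.closedBall (0 : StrongDual ℝ H) M) :=
    WeakDual.isCompact_closedBall 0 M
  have hlsc : LowerSemicontinuous fun l : WeakDual ℝ H => ‖A (R l) - e‖ := by
    intro l c hc
    rcases lt_or_ge c 0 with hc0 | hc0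
    · exact Eventually.of_forall fun l' => hc0.trans_le (norm_nonneg _)
    -- Testing against the residual at `l` itself: the pairing with `w` is weak-* continuous,
    -- exceeds `c * ‖w‖` at `l`, and is at most `‖w‖` times the norm, by Cauchy–Schwarz.
    set w := A (R l) - e with hw
    have hwpos : 0 < ‖w‖ := hc0.trans_lt hc
    have heq : ∀ l' : WeakDual ℝ H,
        ⟪A (R l') - e, w⟫_ℝ = l' (ContinuousLinearMap.adjoint A w) - ⟪e, w⟫_ℝ := by
      intro l'
      rw [inner_sub_left, ← ContinuousLinearMap.adjoint_inner_right, hR]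
    have hcont : Continuous fun l' : WeakDual ℝ H => ⟪A (R l') - e, w⟫_ℝ := by
      simp only [heq]
      exact (WeakDual.eval_continuous _).sub continuous_const
    have hlt : c * ‖w‖ < ⟪A (R l) - e, w⟫_ℝ := by
      rw [← hw, real_inner_self_eq_norm_mul_norm]
      exact mul_lt_mul_of_pos_right hc hwpos
    filter_upwards [hcont.continuousAt.eventually_const_lt hlt] with l' hl'
    exact lt_of_mul_lt_mul_right (hl'.trans_le (real_inner_le_norm _ _)) hwpos.le
  obtain ⟨l, hl, hmin⟩ := (hlsc.lowerSemicontinuousOn _).exists_isMinOn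
    ⟨0, by simpa using hM⟩ hcpt
  refine ⟨R l, ?_, fun φ hφ => ?_⟩
  · simpa [R] using hl
  · have hmem : StrongDual.toWeakDual (toDual ℝ H φ) ∈
        WeakDual.toStrongDual ⁻¹' Metric.closedBall (0 : StrongDual ℝ H) M := by
      simpa using hφ
    simpa [R] using isMinOn_iff.1 hmin _ hmem

-- Two minimizers with distinct images would have a midpoint, still in the ball, whose residual is
-- strictly shorter by strict convexity of the norm.
omit [CompleteSpace H] [CompleteSpace E] in
lemma eq_of_min_norm_sub_closedBall {A : H →L[ℝ] E} (hA : Function.Injective A) {e : E} {M : ℝ}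
    {φ ψ : H} (hφ : ‖φ‖ ≤ M ∧ ∀ χ : H, ‖χ‖ ≤ M → ‖A φ - e‖ ≤ ‖A χ - e‖)
    (hψ : ‖ψ‖ ≤ M ∧ ∀ χ : H, ‖χ‖ ≤ M → ‖A ψ - e‖ ≤ ‖A χ - e‖) : φ = ψ := by
  have heq : ‖A φ - e‖ = ‖A ψ - e‖ := le_antisymm (hφ.2 ψ hψ.1) (hψ.2 φ hφ.1)
  by_contra hne
  have hne' : A φ - e ≠ A ψ - e := fun h => hne (hA (sub_left_injective h))
  have hlt := norm_combo_lt_of_ne le_rfl heq.ge hne' (a := 1 / 2) (b := 1 / 2)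
    (by norm_num) (by norm_num) (by norm_num)
  have hmid : ‖(1 / 2 : ℝ) • φ + (1 / 2 : ℝ) • ψ‖ ≤ M := by
    refine (norm_add_le _ _).trans ?_
    rw [norm_smul, norm_smul, Real.norm_of_nonneg (by norm_num)]
    linarith [hφ.1, hψ.1]
  have h := hφ.2 _ hmid
  have e1 : A ((1 / 2 : ℝ) • φ + (1 / 2 : ℝ) • ψ) - e =
      (1 / 2 : ℝ) • (A φ - e) + (1 / 2 : ℝ) • (A ψ - e) := by
    rw [map_add, map_smul, map_smul]
    module
  rw [e1] at h
  exact absurd h hlt.not_ge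

-- In the open ball the constraint is inactive, so the minimum is local and by convexity global;
-- dense range then forces a zero residual.
omit [CompleteSpace H] [CompleteSpace E] in
lemma norm_eq_of_min_norm_sub_closedBall {A : H →L[ℝ] E} (hA : DenseRange A) {e : E} {M : ℝ}
    (he : e ∉ range A) {φ : H}
    (hφ : ‖φ‖ ≤ M ∧ ∀ χ : H, ‖χ‖ ≤ M → ‖A φ - e‖ ≤ ‖A χ - e‖) : ‖φ‖ = M := by
  refine le_antisymm hφ.1 (not_lt.1 fun hlt => he ⟨φ, ?_⟩)
  have hconv : ConvexOn ℝ univ fun χ : H => ‖A χ - e‖ := by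
    have h := ((convexOn_norm (E := E) convex_univ).translate_left (-e)).comp_linearMap
      (A : H →ₗ[ℝ] E)
    simpa [Function.comp_def, sub_eq_add_neg] using h
  have hloc : IsLocalMin (fun χ : H => ‖A χ - e‖) φ := by
    filter_upwards [continuous_norm.continuousAt.eventually_lt_const hlt] with χ hχ
    exact hφ.2 χ hχ.le
  have hglob := IsMinOn.of_isLocalMin_of_convex_univ hloc hconv
  rw [← sub_eq_zero, ← norm_le_zero_iff]
  refine le_of_forall_pos_le_add fun ε hε => ?_
  obtain ⟨χ, hχ⟩ := hA.exists_dist_lt e hε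
  rw [dist_comm, dist_eq_norm] at hχ
  rw [zero_add]
  exact (hglob χ).trans hχ.le

/-- The orthogonal complement of the range of the adjoint is the kernel of `B`. -/
lemma denseRange_adjoint_of_injective {B : E →L[ℝ] H} (hB : Function.Injective B) :
    DenseRange (ContinuousLinearMap.adjoint B) := by
  have h := ContinuousLinearMap.orthogonal_range (ContinuousLinearMap.adjoint B)
  rw [ContinuousLinearMap.adjoint_adjoint, LinearMap.ker_eq_bot.2 hB,
    ← Submodule.topologicalClosure_eq_top_iff,
    ← Submodule.dense_iff_topologicalClosure_eq_top] at h
  exact h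

end BestApproximation

/-! ### The squared Cauchy transform and its injectivity -/

section Cauchy

open Filter Topology Complex

/-- Holomorphy of an integral `∫ f(t) k(z, t) dμ(t)` with a kernel that is locally bounded together
with its derivative. -/
lemma hasDerivAt_integral_mul {μ : Measure ℝ} {f : ℝ → ℂ} (hf : Integrable f μ)
    {k dk : ℂ → ℝ → ℂ} {s : Set ℂ} {z₀ : ℂ} (hs : s ∈ 𝓝 z₀) {C D : ℝ}
    (hk : ∀ z, Measurable (k z)) (hdk : Measurable (dk z₀))
    (hC : ∀ᵐ t ∂μ, ‖k z₀ t‖ ≤ C) (hD : ∀ᵐ t ∂μ, ∀ z ∈ s, ‖dk z t‖ ≤ D)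
    (hd : ∀ᵐ t ∂μ, ∀ z ∈ s, HasDerivAt (fun z => k z t) (dk z t) z) :
    HasDerivAt (fun z => ∫ t, k z t * f t ∂μ) (∫ t, dk z₀ t * f t ∂μ) z₀ := by
  refine (hasDerivAt_integral_of_dominated_loc_of_deriv_le
    (F := fun z t => k z t * f t) (F' := fun z t => dk z t * f t)
    (bound := fun t => D * ‖f t‖) hs (Eventually.of_forall fun z => ?_) ?_ ?_ ?_ ?_ ?_).2
  · exact (hk z).aestronglyMeasurable.mul hf.aestronglyMeasurable
  · exact hf.bdd_mul (hk z₀).aestronglyMeasurable hC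
  · exact hdk.aestronglyMeasurable.mul hf.aestronglyMeasurable
  · filter_upwards [hD] with t ht z hz
    rw [norm_mul]
    exact mul_le_mul_of_nonneg_right (ht z hz) (norm_nonneg _)
  · exact hf.norm.const_mul _
  · filter_upwards [hd] with t ht z hz
    exact (ht z hz).mul_const _

/-- The derivative of the Cauchy transform of `f`, up to sign: `∫ f(t) / (z - t)² dμ(t)`. -/
noncomputable def cauchySq (μ : Measure ℝ) (f : ℝ → ℂ) (z : ℂ) : ℂ :=
  ∫ t, ((z - t) ^ 2)⁻¹ * f t ∂μ

lemma abs_im_le_norm_sub (z : ℂ) (t : ℝ) : |z.im| ≤ ‖z - t‖ := by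
  simpa using abs_im_le_norm (z - t)

lemma differentiableAt_cauchySq {μ : Measure ℝ} {f : ℝ → ℂ} (hf : Integrable f μ) {z : ℂ}
    (hz : z.im ≠ 0) : DifferentiableAt ℂ (cauchySq μ f) z := by
  have hd : 0 < |z.im| / 2 := by positivity
  -- On this neighbourhood the distance to the real axis stays above half its value at `z`, which
  -- bounds the differentiated kernel uniformly in `t`.
  have hs : {w : ℂ | |z.im| / 2 < |w.im|} ∈ 𝓝 z :=
    (isOpen_lt continuous_const (by fun_prop)).mem_nhds (by simp; positivity)
  have hne : ∀ w ∈ {w : ℂ | |z.im| / 2 < |w.im|}, ∀ t : ℝ, |z.im| / 2 ≤ ‖w - t‖ :=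
    fun w hw t => (le_of_lt hw).trans (abs_im_le_norm_sub w t)
  refine (hasDerivAt_integral_mul hf (k := fun w t => ((w - t) ^ 2)⁻¹)
    (dk := fun w t => -(2 * (w - t)) / ((w - t) ^ 2) ^ 2) (C := ((|z.im| / 2) ^ 2)⁻¹)
    (D := 2 / (|z.im| / 2) ^ 3) hs
    (fun w => by fun_prop) (by fun_prop) (ae_of_all _ fun t => ?_)
    (ae_of_all _ fun t w hw => ?_) (ae_of_all _ fun t w hw => ?_)).differentiableAt
  · rw [norm_inv, norm_pow]
    have := hne z (mem_of_mem_nhds hs) t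
    gcongr
  · have h := hne w hw t
    have hpos := hd.trans_le h
    have : ‖-(2 * (w - t)) / ((w - t) ^ 2) ^ 2‖ = 2 / ‖w - t‖ ^ 3 := by
      simp only [norm_div, norm_neg, norm_mul, norm_pow, Complex.norm_ofNat]
      field_simp
    rw [this]
    gcongr
  · have hpos := hd.trans_le (hne w hw t)
    have h0 : (w - t) ^ 2 ≠ 0 := pow_ne_zero _ (norm_pos_iff.1 hpos)
    refine ((((hasDerivAt_id w).sub_const (t : ℂ)).fun_pow 2).fun_inv h0).congr_deriv ?_
    simp

lemma norm_cauchySq_le {μ : Measure ℝ} {f : ℝ → ℂ} (hf : Integrable f μ) {z : ℂ}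
    (hz : z.im ≠ 0) : ‖cauchySq μ f z‖ ≤ (∫ t, ‖f t‖ ∂μ) / |z.im| ^ 2 := by
  have hd : 0 < |z.im| := abs_pos.2 hz
  rw [div_eq_inv_mul, ← integral_const_mul]
  refine norm_integral_le_of_norm_le (hf.norm.const_mul _) (ae_of_all _ fun t => ?_)
  rw [norm_mul, norm_inv, norm_pow]
  have := abs_im_le_norm_sub z t
  gcongr

lemma conj_cauchySq (μ : Measure ℝ) (f : ℝ → ℂ) (z : ℂ) :
    (starRingEnd ℂ) (cauchySq μ f z) =
      cauchySq μ (fun t => (starRingEnd ℂ) (f t)) ((starRingEnd ℂ) z) := by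
  simp only [cauchySq, ← integral_conj, map_mul, map_inv₀, map_pow, map_sub, conj_ofReal]

/-- A function with vanishing moments on a bounded interval vanishes. -/
lemma ae_eq_zero_of_moments {a b : ℝ} {f : ℝ → ℂ} (hf : Integrable f (volume.restrict (Ioo a b)))
    (h : ∀ n : ℕ, ∫ t in Ioo a b, (t : ℂ) ^ n * f t = 0) :
    ∀ᵐ t ∂volume.restrict (Ioo a b), f t = 0 := by
  refine ae_eq_zero_of_integral_contDiff_smul_eq_zero hf.locallyIntegrable fun g hg _ => ?_
  have hbdd : ∀ p : ℝ → ℝ, Continuous p →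
      Integrable (fun t => p t • f t) (volume.restrict (Ioo a b)) := by
    intro p hp
    obtain ⟨C, hC⟩ := (isCompact_Icc (a := a) (b := b)).exists_bound_of_continuousOn hp.continuousOn
    refine hf.bdd_smul C hp.aestronglyMeasurable ?_
    filter_upwards [ae_restrict_mem measurableSet_Ioo] with t ht
    exact hC t (Ioo_subset_Icc_self ht)
  have hpoly : ∀ p : Polynomial ℝ, ∫ t in Ioo a b, p.eval t • f t = 0 := by
    intro p
    induction p using Polynomial.induction_on' with
    | add p q hp hq =>
      simp only [Polynomial.eval_add, add_smul]
      rw [integral_add (hbdd _ p.continuous) (hbdd _ q.continuous), hp, hq, add_zero]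
    | monomial n c =>
      have : ∀ t : ℝ, (Polynomial.monomial n c).eval t • f t = (c : ℂ) * ((t : ℂ) ^ n * f t) := by
        intro t
        rw [Polynomial.eval_monomial, real_smul]
        push_cast
        ring
      simp only [this]
      rw [integral_const_mul, h, mul_zero]
  rw [← norm_le_zero_iff]
  refine le_of_forall_pos_le_add fun ε hε => ?_
  set N := ∫ t in Ioo a b, ‖f t‖ with hN
  have hN0 : 0 ≤ N := integral_nonneg fun _ => norm_nonneg _
  -- The denominator is `N + 1` because `N` may be zero.
  obtain ⟨p, hp⟩ := exists_polynomial_near_of_continuousOn a b g hg.continuous.continuousOn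
    (ε / (N + 1)) (by positivity)
  have hsub : ∫ t in Ioo a b, g t • f t = ∫ t in Ioo a b, (g t - p.eval t) • f t := by
    simp only [sub_smul]
    rw [integral_sub (hbdd _ hg.continuous) (hbdd _ p.continuous), hpoly, sub_zero]
  rw [hsub, zero_add]
  calc ‖∫ t in Ioo a b, (g t - p.eval t) • f t‖ ≤ ∫ t in Ioo a b, ε / (N + 1) * ‖f t‖ := by
        refine norm_integral_le_of_norm_le (hf.norm.const_mul _) ?_
        filter_upwards [ae_restrict_mem measurableSet_Ioo] with t ht
        rw [norm_smul, Real.norm_eq_abs, abs_sub_comm]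
        exact mul_le_mul_of_nonneg_right (hp t (Ioo_subset_Icc_self ht)).le (norm_nonneg _)
    _ = ε * (N / (N + 1)) := by rw [integral_const_mul, ← hN]; ring
    _ ≤ ε * 1 := by
        gcongr
        rw [div_le_one (by positivity)]
        linarith
    _ = ε := mul_one ε

/-- The transform is injective: it determines the function from its values on the upper
half-plane. -/
lemma ae_eq_zero_of_cauchySq_eq_zero {a b : ℝ} {f : ℝ → ℂ}
    (hf : Integrable f (volume.restrict (Ioo a b)))
    (h : ∀ z : ℂ, 0 < z.im → cauchySq (volume.restrict (Ioo a b)) f z = 0) :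
    ∀ᵐ t ∂volume.restrict (Ioo a b), f t = 0 := by
  set μ := volume.restrict (Ioo a b) with hμ
  set R := |a| + |b| + 1 with hR
  have hRpos : 0 < R := by positivity
  -- With `r = 1 / (2R)`, the product `u * t` has modulus at most `1/2` on the disc of radius `r`,
  -- so `1 - u * t` stays away from zero.
  have hle : ∀ᵐ t ∂μ, |t| ≤ R := by
    filter_upwards [ae_restrict_mem measurableSet_Ioo] with t ht
    rw [abs_le]
    constructor <;> linarith [ht.1, ht.2, neg_abs_le a, le_abs_self b, abs_nonneg a, abs_nonneg b]
  set r := 1 / (2 * R) with hr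
  have hrpos : 0 < r := by positivity
  have hlow : ∀ t : ℝ, |t| ≤ R → ∀ u ∈ Metric.ball (0 : ℂ) r, 1 / 2 ≤ ‖1 - u * t‖ := by
    intro t ht u hu
    have hu' : ‖u‖ ≤ r := (mem_ball_zero_iff.1 hu).le
    have h1 : ‖u * t‖ ≤ 1 / 2 := by
      rw [norm_mul, norm_real, Real.norm_eq_abs]
      calc ‖u‖ * |t| ≤ r * R := by gcongr
        _ = 1 / 2 := by rw [hr]; field_simp
    have h2 := norm_sub_norm_le (1 : ℂ) (u * t)
    rw [norm_one] at h2
    linarith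
  have hint : ∀ n : ℕ, Integrable (fun t : ℝ => (t : ℂ) ^ n * f t) μ := by
    intro n
    refine hf.bdd_mul (c := R ^ n) (by fun_prop) ?_
    filter_upwards [hle] with t ht
    rw [norm_pow, norm_real, Real.norm_eq_abs]
    gcongr
  -- In the coordinate `u = 1/z` at infinity, `G 0 u` is the transform at `u⁻¹` divided by `u²`. The
  -- factors are chosen so that differentiation leads from `G n` to `(n + 2) * G (n + 1)` and `G n
  -- 0` is the `n`-th moment.
  let G : ℕ → ℂ → ℂ := fun n u => ∫ t : ℝ, ((1 - u * t) ^ (n + 2))⁻¹ * ((t : ℂ) ^ n * f t) ∂μ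
  have hG : ∀ n, ∀ u ∈ Metric.ball (0 : ℂ) r, HasDerivAt (G n) ((n + 2) * G (n + 1) u) u := by
    intro n u hu
    have hs := Metric.isOpen_ball.mem_nhds hu
    have hder := hasDerivAt_integral_mul (hint n) (z₀ := u) (s := Metric.ball (0 : ℂ) r)
      (k := fun u t => ((1 - u * t) ^ (n + 2))⁻¹)
      (dk := fun u t => (n + 2) * t * ((1 - u * t) ^ (n + 3))⁻¹)
      (C := ((1 / 2) ^ (n + 2))⁻¹) (D := (n + 2) * R * ((1 / 2) ^ (n + 3))⁻¹) hs
      (fun w => by fun_prop) (by fun_prop) ?_ ?_ ?_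
    · refine hder.congr_deriv ?_
      simp only [G]
      rw [← integral_const_mul]
      refine integral_congr_ae (ae_of_all _ fun t => ?_)
      simp only
      ring
    · filter_upwards [hle] with t ht
      have := hlow t ht u hu
      rw [norm_inv, norm_pow]
      gcongr
    · filter_upwards [hle] with t ht w hw
      have := hlow t ht w hw
      have hn : ‖(n : ℂ) + 2‖ = n + 2 := by
        exact_mod_cast Complex.norm_natCast (n + 2)
      rw [norm_mul, norm_mul, norm_inv, norm_pow, hn, norm_real, Real.norm_eq_abs]
      gcongr
    · filter_upwards [hle] with t ht w hw
      have hpos : 0 < ‖1 - w * t‖ := lt_of_lt_of_le (by norm_num) (hlow t ht w hw)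
      have hne : 1 - w * t ≠ 0 := norm_pos_iff.1 hpos
      have h1 : HasDerivAt (fun w : ℂ => 1 - w * t) (-t) w := by
        simpa using ((hasDerivAt_id w).mul_const (t : ℂ)).const_sub 1
      refine ((h1.fun_pow (n + 2)).fun_inv (pow_ne_zero _ hne)).congr_deriv ?_
      simp only [Nat.add_succ_sub_one]
      field_simp
      push_cast
      ring
  -- Inversion sends the lower half of the disc into the upper half-plane, where the transform
  -- vanishes; the identity theorem covers the rest of the disc, including `0`.
  have hG0 : EqOn (G 0) 0 (Metric.ball 0 r) := by
    have han : AnalyticOnNhd ℂ (G 0) (Metric.ball 0 r) :=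
      DifferentiableOn.analyticOnNhd
        (fun u hu => (hG 0 u hu).differentiableAt.differentiableWithinAt) Metric.isOpen_ball
    have hmem : -(r / 2 : ℝ) * I ∈ Metric.ball (0 : ℂ) r := by
      simp [abs_of_pos hrpos]
      linarith
    refine han.eqOn_zero_of_preconnected_of_eventuallyEq_zero
      (convex_ball _ _).isPreconnected hmem ?_
    have hopen : {u : ℂ | u.im < 0} ∈ 𝓝 (-(r / 2 : ℝ) * I) :=
      (isOpen_lt continuous_im continuous_const).mem_nhds (by simp [hrpos])
    filter_upwards [hopen] with u hu
    have hu' : u.im < 0 := hu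
    have hu0 : u ≠ 0 := fun h0 => by simp [h0] at hu'
    have him : 0 < (u⁻¹).im := by
      rw [inv_im]
      exact div_pos (by linarith) (normSq_pos.2 hu0)
    have h1 := h _ him
    have h2 : cauchySq μ f u⁻¹ = u ^ 2 * G 0 u := by
      simp only [cauchySq, G]
      rw [← integral_const_mul]
      refine integral_congr_ae (ae_of_all _ fun t => ?_)
      have : (u⁻¹ - t) = u⁻¹ * (1 - u * t) := by field_simp
      simp only [this, mul_pow, mul_inv, inv_inv, inv_pow]
      ring
    rw [h2] at h1
    exact (mul_eq_zero.1 h1).resolve_left (pow_ne_zero _ hu0)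
  have hGn : ∀ n, EqOn (G n) 0 (Metric.ball 0 r) := by
    intro n
    induction n with
    | zero => exact hG0
    | succ n ih =>
      intro u hu
      have h1 : HasDerivAt (G n) 0 u :=
        (hasDerivAt_const u (0 : ℂ)).congr_of_eventuallyEq
          (ih.eventuallyEq_of_mem (Metric.isOpen_ball.mem_nhds hu))
      have h2 := (hG n u hu).unique h1
      have h3 : (n : ℂ) + 2 ≠ 0 := by exact_mod_cast (Nat.succ_ne_zero (n + 1))
      exact (mul_eq_zero.1 h2).resolve_left h3
  refine ae_eq_zero_of_moments hf fun n => ?_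
  have := hGn n (Metric.mem_ball_self hrpos)
  simpa [G] using this

end Cauchy

/-! ### From the real kernels to holomorphic functions -/

section Kernel

open Filter Topology Complex

lemma inv_sq_eq_kernel {h : ℝ} (hh : 0 < h) (x : ℝ) :
    (((x : ℂ) + h * I) ^ 2)⁻¹ = Real.pi * (dP h x + dQ h x * I) := by
  have hpi : (Real.pi : ℂ) ≠ 0 := ofReal_ne_zero.2 Real.pi_ne_zero
  have hR : x ^ 2 + h ^ 2 ≠ 0 := by positivity
  have hC : (x : ℂ) ^ 2 + (h : ℂ) ^ 2 ≠ 0 := by exact_mod_cast hR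
  have hprod : ((x : ℂ) + h * I) * (x - h * I) = x ^ 2 + h ^ 2 := by
    ring_nf
    simp
  have h1 : (x : ℂ) + h * I ≠ 0 := left_ne_zero_of_mul (hprod ▸ hC)
  have hdP : (dP h x : ℂ) + dQ h x * I =
      1 / Real.pi * ((x - h * I) ^ 2 / (x ^ 2 + h ^ 2) ^ 2) := by
    simp only [dP, dQ]
    push_cast
    field_simp
    ring_nf
    simp
    ring
  rw [hdP, ← hprod]
  have h2 : (x : ℂ) - h * I ≠ 0 := right_ne_zero_of_mul (hprod ▸ hC)
  field_simp

/-- Identity theorem on a domain that contains the real line. -/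
lemma eqOn_zero_of_ae_real {U : Set ℂ} (hU : IsOpen U) (hU' : IsPreconnected U)
    (hreal : ∀ x : ℝ, (x : ℂ) ∈ U) {Φ : ℂ → ℂ} (hΦ : DifferentiableOn ℂ Φ U) {a b : ℝ}
    (hab : a < b) (h0 : ∀ᵐ x ∂volume.restrict (Ioo a b), Φ (x : ℝ) = 0) : EqOn Φ 0 U := by
  have hcont : Continuous fun x : ℝ => Φ x :=
    hΦ.continuousOn.comp_continuous continuous_ofReal hreal
  -- Continuity upgrades almost everywhere to everywhere on the interval.
  have hIoo : EqOn (fun x : ℝ => Φ x) (fun _ => 0) (Ioo a b) :=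
    Measure.eqOn_open_of_ae_eq h0 isOpen_Ioo hcont.continuousOn continuousOn_const
  obtain ⟨c, hc⟩ := exists_between hab
  refine (hΦ.analyticOnNhd hU).eqOn_zero_of_preconnected_of_frequently_eq_zero hU' (hreal c) ?_
  have hfreq : ∃ᶠ x : ℝ in 𝓝[≠] c, Φ x = 0 := by
    refine Eventually.frequently (eventually_nhdsWithin_of_eventually_nhds ?_)
    filter_upwards [isOpen_Ioo.mem_nhds hc] with x hx using hIoo hx
  have ht : Tendsto (fun x : ℝ => (x : ℂ)) (𝓝[≠] c) (𝓝[≠] (c : ℂ)) :=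
    tendsto_nhdsWithin_of_tendsto_nhds_of_eventually_within _
      (continuous_ofReal.continuousAt.mono_left nhdsWithin_le_nhds)
      (eventually_nhdsWithin_of_forall fun x hx => by simpa using hx)
  exact ht.frequently hfreq

/-- If the shifts by `±h` of the transform of `g` and of its conjugate cancel on a real interval,
then `g` vanishes. -/
lemma ae_eq_zero_of_cauchySq_add_conj {a b c d h : ℝ} (hh : 0 < h) (hcd : c < d) {g : ℝ → ℂ}
    (hg : Integrable g (volume.restrict (Ioo a b)))
    (h0 : ∀ᵐ x ∂volume.restrict (Ioo c d),
      cauchySq (volume.restrict (Ioo a b)) g ((x : ℝ) + h * I) +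
      cauchySq (volume.restrict (Ioo a b)) (fun t => (starRingEnd ℂ) (g t)) (x - h * I) = 0) :
    ∀ᵐ t ∂volume.restrict (Ioo a b), g t = 0 := by
  set μ := volume.restrict (Ioo a b) with hμ
  have hg' : Integrable (fun t => (starRingEnd ℂ) (g t)) μ :=
    hg.mono (continuous_conj.comp_aestronglyMeasurable hg.aestronglyMeasurable)
      (ae_of_all _ fun t => by simp)
  set F : ℂ → ℂ := fun z => cauchySq μ g (z + h * I) with hF
  set F' : ℂ → ℂ := fun z => -cauchySq μ (fun t => (starRingEnd ℂ) (g t)) (z - h * I) with hF'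
  have hFd : ∀ z : ℂ, -h < z.im → DifferentiableAt ℂ F z := fun z hz => by
    refine DifferentiableAt.comp (g := cauchySq μ g) (f := fun z => z + h * I) z
      (differentiableAt_cauchySq hg ?_) (by fun_prop)
    simp only [add_im, mul_im, ofReal_re, ofReal_im, I_re, I_im]
    linarith
  have hFd' : ∀ z : ℂ, z.im < h → DifferentiableAt ℂ F' z := fun z hz => by
    refine (DifferentiableAt.comp z (differentiableAt_cauchySq hg' ?_) (by fun_prop)).neg
    simp only [sub_im, mul_im, ofReal_re, ofReal_im, I_re, I_im]
    linarith
  have hstrip : ∀ z : ℂ, -h < z.im → z.im < h → F z = F' z := by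
    have hopen : IsOpen {z : ℂ | -h < z.im ∧ z.im < h} :=
      (isOpen_lt continuous_const continuous_im).inter (isOpen_lt continuous_im continuous_const)
    have hconv : Convex ℝ {z : ℂ | -h < z.im ∧ z.im < h} :=
      (convex_halfSpace_im_gt (-h)).inter (convex_halfSpace_im_lt h)
    have := eqOn_zero_of_ae_real hopen hconv.isPreconnected (Φ := fun z => F z - F' z)
      (fun x => by simp [hh]) (fun z hz =>
        ((hFd z hz.1).sub (hFd' z hz.2)).differentiableWithinAt) hcd
      (by simpa [hF, hF'] using h0)
    exact fun z h1 h2 => sub_eq_zero.1 (this ⟨h1, h2⟩)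
  -- `F` and `F'` agree on the strip `|Im z| < h`, so gluing them along the real axis gives an
  -- entire function.
  let E : ℂ → ℂ := fun z => if 0 ≤ z.im then F z else F' z
  have hE : ∀ z : ℂ, -h < z.im → E z = F z := fun z hz => by
    by_cases h0 : 0 ≤ z.im
    · simp [E, h0]
    · simp [E, h0, hstrip z hz (by linarith)]
  have hE' : ∀ z : ℂ, z.im < h → E z = F' z := fun z hz => by
    by_cases h0 : 0 ≤ z.im
    · simp [E, h0, hstrip z (by linarith) hz]
    · simp [E, h0]
  have hEd : Differentiable ℂ E := by
    intro z
    rcases lt_or_ge (-h) z.im with hz | hz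
    · refine (hFd z hz).congr_of_eventuallyEq ?_
      filter_upwards [(isOpen_lt continuous_const continuous_im).mem_nhds hz] with w hw
      exact hE w hw
    · have hz' : z.im < h := by linarith
      refine (hFd' z hz').congr_of_eventuallyEq ?_
      filter_upwards [(isOpen_lt continuous_im continuous_const).mem_nhds hz'] with w hw
      exact hE' w hw
  set N := ∫ t, ‖g t‖ ∂μ with hN
  have hN0 : 0 ≤ N := integral_nonneg fun _ => norm_nonneg _
  have hFle : ∀ z : ℂ, 0 ≤ z.im → ‖F z‖ ≤ N / (z.im + h) ^ 2 := fun z hz => by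
    have him : (z + h * I).im = z.im + h := by simp
    have := norm_cauchySq_le hg (z := z + h * I) (by rw [him]; positivity)
    rwa [him, sq_abs] at this
  have hFle' : ∀ z : ℂ, z.im ≤ 0 → ‖F' z‖ ≤ N / (z.im - h) ^ 2 := fun z hz => by
    have him : (z - h * I).im = z.im - h := by simp
    have := norm_cauchySq_le hg' (z := z - h * I) (by rw [him]; linarith)
    rw [him, sq_abs] at this
    simpa [hF', hN] using this
  have hbdd : Bornology.IsBounded (range E) := by
    refine isBounded_iff_forall_norm_le.2 ⟨N / h ^ 2, ?_⟩
    rintro _ ⟨z, rfl⟩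
    rcases le_total 0 z.im with hz | hz
    · rw [hE z (by linarith)]
      refine (hFle z hz).trans ?_
      gcongr
      linarith
    · rw [hE' z (by linarith)]
      refine (hFle' z hz).trans ?_
      refine div_le_div_of_nonneg_left hN0 (by positivity) ?_
      nlinarith
  -- `E` is constant by Liouville, and the bound on `F` tends to zero along the positive imaginary
  -- axis.
  have hE0 : ∀ z, E z = 0 := by
    intro z
    have hlim : Tendsto (fun y : ℝ => N / (y + h) ^ 2) atTop (𝓝 0) :=
      tendsto_const_nhds.div_atTop
        ((tendsto_pow_atTop two_ne_zero).comp (tendsto_atTop_add_const_right _ _ tendsto_id))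
    rw [← norm_le_zero_iff]
    refine ge_of_tendsto hlim ?_
    filter_upwards [eventually_ge_atTop 0] with y hy
    rw [hEd.apply_eq_apply_of_bounded hbdd z (y * I)]
    have him : ((y : ℂ) * I).im = y := by simp
    have := hFle (y * I) (by rwa [him])
    rw [hE _ (by rw [him]; linarith)]
    rwa [him] at this
  refine ae_eq_zero_of_cauchySq_eq_zero hg fun z hz => ?_
  have him : -h < (z - h * I).im := by simp [hz]
  have h1 := hE _ him
  rw [hE0] at h1
  simpa [hF] using h1.symm

end Kernel

/-! ### Injectivity of the operator and of its adjoint -/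

section Injectivity

open Filter Topology Complex InnerProductSpace

/-- The field is determined by the transform of `m₂ - i m₁`. -/
lemma cauchySq_add_conj_eq_field {a b h : ℝ} (hh : 0 < h) (m : L2Vec a b) (x : ℝ) :
    cauchySq (volume.restrict (Ioo a b)) (fun t => (m t 1 : ℂ) - m t 0 * I) (x + h * I) +
      cauchySq (volume.restrict (Ioo a b))
        (fun t => (starRingEnd ℂ) ((m t 1 : ℂ) - m t 0 * I)) (x - h * I) =
      ((-(2 * Real.pi) * field h m x : ℝ) : ℂ) := by
  -- The second summand is the conjugate of the first, so the sum is twice a real part; only that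
  -- part of the kernel product enters the field.
  have hconj : (x : ℂ) - h * I = (starRingEnd ℂ) (x + h * I) := by simp [sub_eq_add_neg]
  rw [hconj, ← conj_cauchySq, add_conj, field_eq hh,
    ← integral_add (integrable_dQ hh m x) (integrable_dP hh m x), cauchySq]
  have hint : ∀ t : ℝ, ((((x : ℂ) + h * I) - t) ^ 2)⁻¹ * ((m t 1 : ℂ) - m t 0 * I) =
      ((Real.pi * (dQ h (x - t) * m t 0 + dP h (x - t) * m t 1) : ℝ) : ℂ) +
      ((Real.pi * (dQ h (x - t) * m t 1 - dP h (x - t) * m t 0) : ℝ) : ℂ) * I := by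
    intro t
    have h1 : ((x : ℂ) + h * I) - t = ((x - t : ℝ) : ℂ) + h * I := by push_cast; ring
    rw [h1, inv_sq_eq_kernel hh]
    push_cast
    ring_nf
    simp only [I_sq]
    ring
  have hQ : ∀ i, Integrable (fun t => dQ h (x - t) * m t i) (volume.restrict (Ioo a b)) :=
    fun i => integrable_kernel m i (measurable_dQ.comp measurable_prodMk_left)
      (fun x => (abs_kernel_le hh le_rfl x).1) x
  have hP : ∀ i, Integrable (fun t => dP h (x - t) * m t i) (volume.restrict (Ioo a b)) :=
    fun i => integrable_kernel m i (measurable_dP.comp measurable_prodMk_left)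
      (fun x => (abs_kernel_le hh le_rfl x).2) x
  simp only [hint]
  have h0 : Integrable (fun t =>
      ((Real.pi * (dQ h (x - t) * m t 0 + dP h (x - t) * m t 1) : ℝ) : ℂ))
      (volume.restrict (Ioo a b)) := (((hQ 0).add (hP 1)).const_mul _).ofReal
  have h1 : Integrable (fun t =>
      ((Real.pi * (dQ h (x - t) * m t 1 - dP h (x - t) * m t 0) : ℝ) : ℂ))
      (volume.restrict (Ioo a b)) := (((hQ 1).sub (hP 0)).const_mul _).ofReal
  rw [integral_add h0 (h1.mul_const I), integral_mul_const, integral_complex_ofReal,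
    integral_complex_ofReal, integral_const_mul, add_re, re_ofReal_mul, I_re, mul_zero, add_zero,
    ofReal_re]
  congr 1
  ring

/-- There are no silent magnetizations supported on a bounded interval. -/
lemma b2_injective {s₁ s₂ k₁ k₂ h : ℝ} (hK : k₁ < k₂) (hh : 0 < h) :
    Function.Injective (b2 s₁ s₂ k₁ k₂ hh) := by
  rw [injective_iff_map_eq_zero]
  intro m hm
  have hfield : ∀ᵐ x ∂volume.restrict (Ioo k₁ k₂), field h m x = 0 := by
    have h1 : (b2 s₁ s₂ k₁ k₂ hh m : ℝ → ℝ) =ᵐ[volume.restrict (Ioo k₁ k₂)] field h m :=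
      (memLp_field hh k₁ k₂ m).coeFn_toLp
    rw [hm] at h1
    filter_upwards [h1, Lp.coeFn_zero ℝ 2 (volume.restrict (Ioo k₁ k₂))] with x hx hx0
    rw [← hx, hx0, Pi.zero_apply]
  have hg : Integrable (fun t => (m t 1 : ℂ) - m t 0 * I) (volume.restrict (Ioo s₁ s₂)) :=
    (integrable_comp m 1).ofReal.sub ((integrable_comp m 0).ofReal.mul_const I)
  have hzero := ae_eq_zero_of_cauchySq_add_conj hh hK hg (by
    filter_upwards [hfield] with x hx
    rw [cauchySq_add_conj_eq_field hh, hx, mul_zero, ofReal_zero])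
  rw [Lp.eq_zero_iff_ae_eq_zero]
  filter_upwards [hzero] with t ht
  have h1 := congrArg re ht
  have h0 := congrArg im ht
  simp at h1 h0
  ext i
  fin_cases i <;> simp [h0, h1]

/-- On the kernel of the adjoint operator, the integral operators that form its two components
vanish. -/
lemma ae_kernel_eq_zero_of_b2Adjoint {s₁ s₂ k₁ k₂ h : ℝ} (hh : 0 < h) {φ : L2 k₁ k₂}
    (hφ : b2Adjoint s₁ s₂ k₁ k₂ hh φ = 0) :
    ∀ᵐ t ∂volume.restrict (Ioo s₁ s₂),
      (∫ x in Ioo k₁ k₂, dQ h (x - t) * φ x) = 0 ∧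
      (∫ x in Ioo k₁ k₂, dP h (x - t) * φ x) = 0 := by
  set μ := volume.restrict (Ioo s₁ s₂) with hμ
  set ν := volume.restrict (Ioo k₁ k₂) with hν
  have hφi : Integrable φ ν := (Lp.memLp φ).integrable (by norm_num)
  have hker : ∀ k : ℝ → ℝ → ℝ, Measurable (Function.uncurry k) → (∀ x, |k h x| ≤ 1 / h ^ 2) →
      StronglyMeasurable (fun t => ∫ x, k h (x - t) * φ x ∂ν) ∧
      (∀ t, |∫ x, k h (x - t) * φ x ∂ν| ≤ 1 / h ^ 2 * ∫ x, ‖φ x‖ ∂ν) := by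
    intro k hk hkb
    constructor
    · have hk' : StronglyMeasurable fun p : ℝ × ℝ => k h (p.2 - p.1) :=
        (hk.comp (measurable_const.prodMk
          (measurable_snd.sub measurable_fst))).stronglyMeasurable
      exact (hk'.mul ((Lp.stronglyMeasurable φ).comp_measurable
        measurable_snd)).integral_prod_right
    · intro t
      rw [← integral_const_mul, ← Real.norm_eq_abs]
      refine norm_integral_le_of_norm_le (hφi.norm.const_mul _) (ae_of_all _ fun x => ?_)
      rw [norm_mul]
      exact mul_le_mul_of_nonneg_right (hkb _) (norm_nonneg _)
  have hQb : ∀ x, |dQ h x| ≤ 1 / h ^ 2 := fun x => (abs_kernel_le hh le_rfl x).1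
  have hPb : ∀ x, |dP h x| ≤ 1 / h ^ 2 := fun x => (abs_kernel_le hh le_rfl x).2
  obtain ⟨hU0m, hU0b⟩ := hker dQ measurable_dQ hQb
  obtain ⟨hU1m, hU1b⟩ := hker dP measurable_dP hPb
  set U0 : ℝ → ℝ := fun t => ∫ x, dQ h (x - t) * φ x ∂ν with hU0
  set U1 : ℝ → ℝ := fun t => ∫ x, dP h (x - t) * φ x ∂ν with hU1
  have hV : MemLp (fun t => (!₂[U0 t, U1 t] : EuclideanSpace ℝ (Fin 2))) 2 μ := by
    rw [memLp_piLp_iff]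
    intro i
    fin_cases i
    · exact MemLp.of_bound hU0m.aestronglyMeasurable _ (ae_of_all _ hU0b)
    · exact MemLp.of_bound hU1m.aestronglyMeasurable _ (ae_of_all _ hU1b)
  -- The kernel integrals themselves serve as the test magnetization: by Fubini, `⟪φ, b2 m⟫` equals
  -- `-∫ (U0² + U1²)`, so no formula for the adjoint is needed.
  set m : L2Vec s₁ s₂ := hV.toLp _ with hm
  have hmV : ∀ᵐ t ∂μ, m t 0 = U0 t ∧ m t 1 = U1 t := by
    filter_upwards [hV.coeFn_toLp] with t ht
    rw [hm, ht]
    simp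
  have hfub : ∀ (i : Fin 2) (k : ℝ → ℝ → ℝ), Measurable (Function.uncurry k) →
      (∀ x, |k h x| ≤ 1 / h ^ 2) →
      Integrable (fun x => φ x * ∫ t, k h (x - t) * m t i ∂μ) ν ∧
      ∫ x, φ x * ∫ t, k h (x - t) * m t i ∂μ ∂ν =
        ∫ t, m t i * ∫ x, k h (x - t) * φ x ∂ν ∂μ := by
    intro i k hk hkb
    have hk' : Measurable fun p : ℝ × ℝ => k h (p.1 - p.2) :=
      hk.comp (measurable_const.prodMk (measurable_fst.sub measurable_snd))
    have hi : Integrable (fun p : ℝ × ℝ => k h (p.1 - p.2) * (φ p.1 * m p.2 i)) (ν.prod μ) :=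
      (hφi.mul_prod (integrable_comp m i)).bdd_mul (c := 1 / h ^ 2) hk'.aestronglyMeasurable
        (ae_of_all _ fun p => hkb _)
    have hl : ∀ x, ∫ t, k h (x - t) * (φ x * m t i) ∂μ = φ x * ∫ t, k h (x - t) * m t i ∂μ := by
      intro x
      rw [← integral_const_mul]
      congr 1 with t
      ring
    have hr : ∀ t, ∫ x, k h (x - t) * (φ x * m t i) ∂ν = m t i * ∫ x, k h (x - t) * φ x ∂ν := by
      intro t
      rw [← integral_const_mul]
      congr 1 with x
      ring
    refine ⟨by simpa only [hl] using hi.integral_prod_left, ?_⟩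
    have := integral_integral_swap
      (f := fun x t => k h (x - t) * (φ x * m t i)) hi
    simpa only [hl, hr] using this
  have hinner : ⟪φ, b2 s₁ s₂ k₁ k₂ hh m⟫_ℝ = 0 := by
    rw [← ContinuousLinearMap.adjoint_inner_left]
    change ⟪b2Adjoint s₁ s₂ k₁ k₂ hh φ, m⟫_ℝ = 0
    rw [hφ, inner_zero_left]
  obtain ⟨hi0, he0⟩ := hfub 0 dQ measurable_dQ hQb
  obtain ⟨hi1, he1⟩ := hfub 1 dP measurable_dP hPb
  have hsum : ∫ t, U0 t ^ 2 + U1 t ^ 2 ∂μ = 0 := by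
    have h1 : ⟪φ, b2 s₁ s₂ k₁ k₂ hh m⟫_ℝ = ∫ x, -(φ x * ∫ t, dQ h (x - t) * m t 0 ∂μ +
        φ x * ∫ t, dP h (x - t) * m t 1 ∂μ) ∂ν := by
      rw [L2.inner_def]
      refine integral_congr_ae ?_
      filter_upwards [(memLp_field hh k₁ k₂ m).coeFn_toLp] with x hx
      have hx' : (b2 s₁ s₂ k₁ k₂ hh m : ℝ → ℝ) x = field h m x := hx
      rw [hx', field_eq hh, RCLike.inner_apply, conj_trivial]
      ring
    rw [hinner, integral_neg, integral_add hi0 hi1, he0, he1, eq_comm, neg_eq_zero] at h1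
    have hb : ∀ i (U : ℝ → ℝ), StronglyMeasurable U →
        (∀ t, |U t| ≤ 1 / h ^ 2 * ∫ x, ‖φ x‖ ∂ν) → Integrable (fun t => m t i * U t) μ :=
      fun i U hU hb => (integrable_comp m i).mul_bdd hU.aestronglyMeasurable
        (ae_of_all _ hb)
    rw [← integral_add (hb 0 U0 hU0m hU0b) (hb 1 U1 hU1m hU1b)] at h1
    rw [← h1]
    refine integral_congr_ae ?_
    filter_upwards [hmV] with t ht
    rw [ht.1, ht.2]
    ring
  have hsqi : Integrable (fun t => U0 t ^ 2 + U1 t ^ 2) μ := by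
    exact (MemLp.of_bound hU0m.aestronglyMeasurable _ (ae_of_all _ hU0b)).integrable_sq.add
      (MemLp.of_bound hU1m.aestronglyMeasurable _ (ae_of_all _ hU1b)).integrable_sq
  filter_upwards [(integral_eq_zero_iff_of_nonneg (fun t => by positivity) hsqi).1 hsum] with t ht
  have ht' : U0 t ^ 2 + U1 t ^ 2 = 0 := ht
  constructor <;> nlinarith [sq_nonneg (U0 t), sq_nonneg (U1 t)]

/-- The two vanishing kernel integrals are, up to the factor `π`, the real and imaginary parts of
the transform of `φ` on the line `Im = -h`. It therefore vanishes on a segment of that line, then on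
the whole lower half-plane. -/
lemma b2Adjoint_injective {s₁ s₂ k₁ k₂ h : ℝ} (hS : s₁ < s₂) (hh : 0 < h) :
    Function.Injective (b2Adjoint s₁ s₂ k₁ k₂ hh) := by
  rw [injective_iff_map_eq_zero]
  intro φ hφ
  set ν := volume.restrict (Ioo k₁ k₂) with hν
  have hφi : Integrable φ ν := (Lp.memLp φ).integrable (by norm_num)
  have hφc : Integrable (fun x => (φ x : ℂ)) ν := hφi.ofReal
  have hval : ∀ t : ℝ, cauchySq ν (fun x => (φ x : ℂ)) (t - h * I) =
      Real.pi * ((∫ x, dP h (x - t) * φ x ∂ν : ℝ) + (∫ x, dQ h (x - t) * φ x ∂ν : ℝ) * I) := by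
    intro t
    have hint : ∀ k : ℝ → ℝ → ℝ, Measurable (Function.uncurry k) →
        (∀ x, |k h x| ≤ 1 / h ^ 2) → Integrable (fun x => ((k h (x - t) * φ x : ℝ) : ℂ)) ν :=
      fun k hk hkb => (hφi.bdd_mul (c := 1 / h ^ 2)
        (hk.comp (measurable_const.prodMk (measurable_id.sub
          measurable_const))).aestronglyMeasurable (ae_of_all _ fun _ => hkb _)).ofReal
    have hP := hint dP measurable_dP fun x => (abs_kernel_le hh le_rfl x).2
    have hQ := hint dQ measurable_dQ fun x => (abs_kernel_le hh le_rfl x).1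
    rw [← integral_complex_ofReal, ← integral_complex_ofReal, ← integral_mul_const,
      ← integral_add hP (hQ.mul_const I), ← integral_const_mul, cauchySq]
    congr 1 with x
    have h1 : ((t : ℂ) - h * I - x) ^ 2 = (((x - t : ℝ) : ℂ) + h * I) ^ 2 := by push_cast; ring
    rw [h1, inv_sq_eq_kernel hh]
    push_cast
    ring
  have hlow : EqOn (fun w => cauchySq ν (fun x => (φ x : ℂ)) (w - h * I)) 0 {w : ℂ | w.im < h} := by
    refine eqOn_zero_of_ae_real (isOpen_lt continuous_im continuous_const)
      (convex_halfSpace_im_lt h).isPreconnected (fun x => by simpa using hh)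
      (fun w hw => ?_) hS ?_
    · have hw' : w.im < h := hw
      refine (DifferentiableAt.comp w (differentiableAt_cauchySq hφc ?_)
        (by fun_prop)).differentiableWithinAt
      simp only [sub_im, mul_im, ofReal_re, ofReal_im, I_re, I_im]
      linarith
    · filter_upwards [ae_kernel_eq_zero_of_b2Adjoint hh hφ] with t ht
      rw [hval, ht.1, ht.2]
      simp
  -- Since `φ` is real, conjugation carries the vanishing from the lower to the upper half-plane.
  have hzero := ae_eq_zero_of_cauchySq_eq_zero hφc fun z hz => by
    have h1 : cauchySq ν (fun x => (φ x : ℂ)) ((starRingEnd ℂ) z) = 0 := by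
      have := hlow (x := (starRingEnd ℂ) z + h * I) (by simp [hz])
      simpa using this
    have h2 := conj_cauchySq ν (fun x => (φ x : ℂ)) z
    simp only [conj_ofReal] at h2
    rw [h1] at h2
    exact (map_eq_zero _).1 h2
  rw [Lp.eq_zero_iff_ae_eq_zero]
  filter_upwards [hzero] with x hx using ofReal_eq_zero.1 hx

end Injectivity

end PlanarMagnetization

theorem proposition4p1 (s₁ s₂ k₁ k₂ h : ℝ) (hS : s₁ < s₂) (hK : k₁ < k₂) (hh : 0 < h)
    (e : PlanarMagnetization.L2Vec s₁ s₂) (M : ℝ) (hM : 0 ≤ M) :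
    (∃! φ₀ : PlanarMagnetization.L2 k₁ k₂,
      PlanarMagnetization.IsBEPSolution s₁ s₂ k₁ k₂ hh e M φ₀) ∧
    (e ∉ Set.range (PlanarMagnetization.b2Adjoint s₁ s₂ k₁ k₂ hh) →
      ∀ φ₀ : PlanarMagnetization.L2 k₁ k₂,
        PlanarMagnetization.IsBEPSolution s₁ s₂ k₁ k₂ hh e M φ₀ → ‖φ₀‖ = M) := by
  constructor
  · obtain ⟨φ₀, hφ₀⟩ := PlanarMagnetization.exists_min_norm_sub_closedBall
      (PlanarMagnetization.b2Adjoint s₁ s₂ k₁ k₂ hh) e hM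
    exact ⟨φ₀, hφ₀, fun ψ hψ => PlanarMagnetization.eq_of_min_norm_sub_closedBall
      (PlanarMagnetization.b2Adjoint_injective hS hh) hψ hφ₀⟩
  · exact fun he φ₀ hφ₀ => PlanarMagnetization.norm_eq_of_min_norm_sub_closedBall
      (PlanarMagnetization.denseRange_adjoint_of_injective
        (PlanarMagnetization.b2_injective hK hh)) he hφ₀
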